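/- Let $G$ be a countable discrete group with a proper length function $l:G\to[0,\infty)$ (that is, $l(g)=0$ iff $g=e$, $l(g^{-1})=l(g)$, $l(gh)\le l(g)+l(h)$, and all balls $B(e,r)=\{g: l(g)\le r\}$ are finite), and let $d(x,y)=l(y^{-1}x)$ be the induced proper left-invariant metric. Let $A$ be a unital, not necessarily commutative, $C^*$-algebra. Let $\ell^2(G,A)$ be the standard Hilbert $A$-module of all $\xi:G\to A$ such that $\sum_g \xi(g)^*\xi(g)$ converges in norm, with $\|\xi\|=\|\sum_g \xi(g)^*\xi(g)\|^{1/2}$. A matrix $t:G\times G\to A$ represents a bounded operator $T$ on $\ell^2(G,A)$ if $(T\xi)(x)=\sum_{y\in G}t(x,y)\xi(y)$ (unconditionally norm-convergent) for all $\xi$ and $x$. Let $C[G,A]$ be the algebra of bounded operators on $\ell^2(G,A)$ represented by matrices $t$ of finite propagation (there is $R$ with $t(x,y)=0$ whenever $d(x,y)>R$), and let $C^*(G,A)$, the Roe algebra with coefficients in $A$, be its closure in the operator norm. For $a\ge 0$ and $t:G\times G\to A$ put $$\|t\|_a=\Big(\sum_{\gamma\in G}\big(\sup_{y^{-1}x=\gamma}\|t(x,y)\|\big)^2(1+l(\gamma))^{2a}\Big)^{1/2}\in[0,\infty],$$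 $$W_a(G,A)=\{t:\|t\|_a<\infty\},\qquad W_a^\infty(G,A)=\bigcap_{a\ge 0}W_a(G,A).$$ Suppose that $G$ has $u$-growth for the weight $u(r)=(1+r)^{a_0}$ for some $a_0>0$, i.e. there are $c,s>0$ with $\#B(e,r)<c\,u(r)^s$ for all $r\ge 0$ (polynomial growth). Then: 1. Every $t\in W_a^\infty(G,A)$ represents a unique operator in $C^*(G,A)$, and the operators so obtained form a unital subalgebra of $C^*(G,A)$, again denoted $W_a^\infty(G,A)$. 2. $W_a^\infty(G,A)$ is dense in $C^*(G,A)$. 3. $W_a^\infty(G,A)$ is inverse-closed (spectrally invariant) in $C^*(G,A)$: if $T\in W_a^\infty(G,A)$ is invertible in $C^*(G,A)$, then $T^{-1}\in W_a^\infty(G,A)$; and every $T\in W_a^\infty(G,A)$ has the same spectrum in $W_a^\infty(G,A)$ as in $C^*(G,A)$. 4. $W_a^\infty(G,A)$ is a Fréchet algebra for the norms $\|\cdot\|_a$, $a\ge 0$, continuously included in $C^*(G,A)$: every sequence in it that is Cauchy for every $\|\cdot\|_a$ converges for every $\|\cdot\|_a$ to an element of it; for every $a\ge 0$ there are $b\ge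 0$ and $C\ge 0$ with $\|ST\|_a\le C\|S\|_b\|T\|_b$ for all $S,T\in W_a^\infty(G,A)$; and there are $b\ge 0$ and $C\ge 0$ with $\|T\|\le C\|T\|_b$ for all $T\in W_a^\infty(G,A)$. (Here $\|T\|_a$ is the norm of the matrix that represents $T$.) -/

import Mathlib

open Filter Topology
open scoped ENNReal NNReal

namespace RoeCoeff

/-! ### The standard Hilbert module `ℓ²(G, A)` -/

/-- In the finite column module over a C*-algebra, `ξ ↦ ‖∑ ξᵢ* ξᵢ‖^(1/2)` satisfies the triangle
inequality. -/
theorem finset_triangle {G A : Type*} [CStarAlgebra A] (s : Finset G) (ξ η : G → A) :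
    √‖∑ g ∈ s, star (ξ g + η g) * (ξ g + η g)‖ ≤
      √‖∑ g ∈ s, star (ξ g) * ξ g‖ + √‖∑ g ∈ s, star (η g) * η g‖ := by
  let _ : PartialOrder A := CStarAlgebra.spectralOrder A
  have _ : StarOrderedRing A := CStarAlgebra.spectralOrderedRing A
  let v : (G → A) → WithCStarModule A (s → A) :=
    fun ζ => (WithCStarModule.equiv A (s → A)).symm (fun g => star (ζ g))
  have hv : ∀ ζ, ‖v ζ‖ = √‖∑ g ∈ s, star (ζ g) * ζ g‖ := by
    intro ζ
    rw [WithCStarModule.pi_norm, ← Finset.sum_coe_sort s]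
    simp only [WithCStarModule.inner_def]
    congr 2
    refine Finset.sum_congr rfl fun i _ => ?_
    change star (ζ i) * star (star (ζ i)) = _
    rw [star_star]
  have h := norm_add_le (v ξ) (v η)
  have h2 : v ξ + v η = v (fun g => ξ g + η g) := by
    ext i
    change star (ξ i) + star (η i) = star (ξ i + η i)
    rw [star_add]
  rw [h2, hv ξ, hv η, hv fun g => ξ g + η g] at h
  exact h

/-- The space of all `ξ : G → A` for which `∑ ξ(g)* ξ(g)` converges in norm, as a linear subspace
of the space of all functions. -/
def l2Submodule (G A : Type*) [CStarAlgebra A] : Submodule ℂ (G → A) where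
  carrier := {ξ | Summable fun g => star (ξ g) * ξ g}
  zero_mem' := by simp [summable_zero]
  add_mem' := by
    intro ξ η hξ hη
    simp only [Set.mem_ofPred_eq] at hξ hη ⊢
    rw [summable_iff_vanishing_norm] at hξ hη ⊢
    intro ε hε
    have hδ : 0 < (√ε / 2) ^ 2 := by have := Real.sqrt_pos.2 hε; positivity
    obtain ⟨s, hs⟩ := hξ _ hδ
    obtain ⟨t, ht⟩ := hη _ hδ
    classical
    refine ⟨s ∪ t, fun u hu => ?_⟩
    rw [Finset.disjoint_union_right] at hu
    have h1 := hs u hu.1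
    have h2 := ht u hu.2
    have h3 := finset_triangle u ξ η
    have hp : 0 ≤ √ε / 2 := by positivity
    have h1' := (Real.sqrt_lt' (by have := Real.sqrt_pos.2 hε; positivity)).2 h1
    have h2' := (Real.sqrt_lt' (by have := Real.sqrt_pos.2 hε; positivity)).2 h2
    exact (Real.sqrt_lt_sqrt_iff (norm_nonneg _)).1 (lt_of_le_of_lt h3 (by linarith))
  smul_mem' := by
    intro c ξ hξ
    simp only [Set.mem_ofPred_eq] at hξ ⊢
    have : (fun g => star ((c • ξ) g) * (c • ξ) g) =
        fun g => (star c * c) • (star (ξ g) * ξ g) := by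
      funext g
      simp [smul_smul, mul_comm]
    rw [this]
    exact hξ.const_smul _

/-- The standard (right) Hilbert `A`-module `ℓ²(G, A)`: all `ξ : G → A` such that `∑ ξ(g)* ξ(g)`
converges in norm, with the `A`-valued inner product `⟨ξ, η⟩ = ∑ ξ(g)* η(g)`. -/
def L2 (G A : Type*) [CStarAlgebra A] : Type _ := l2Submodule G A

noncomputable section

variable {G A : Type*} [CStarAlgebra A]

instance : AddCommGroup (L2 G A) := inferInstanceAs (AddCommGroup (l2Submodule G A))

instance : Module ℂ (L2 G A) := inferInstanceAs (Module ℂ (l2Submodule G A))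

instance : CoeFun (L2 G A) (fun _ => G → A) := ⟨Subtype.val⟩

theorem L2.summable (ξ : L2 G A) : Summable fun g => star (ξ g) * ξ g := ξ.2

/-- The Hilbert module norm `‖ξ‖ = ‖⟨ξ, ξ⟩‖^(1/2) = ‖∑ ξ(g)* ξ(g)‖^(1/2)`. -/
instance : Norm (L2 G A) := ⟨fun ξ => √‖∑' g, star (ξ g) * ξ g‖⟩

theorem L2.norm_def (ξ : L2 G A) : ‖ξ‖ = √‖∑' g, star (ξ g) * ξ g‖ := rfl

theorem L2.tendsto_norm (ξ : L2 G A) :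
    Tendsto (fun s : Finset G => √‖∑ g ∈ s, star (ξ g) * ξ g‖) atTop (𝓝 ‖ξ‖) :=
  ((Real.continuous_sqrt.comp continuous_norm).tendsto _).comp ξ.summable.hasSum

theorem L2.norm_apply_le (ξ : L2 G A) (g : G) : ‖ξ g‖ ≤ ‖ξ‖ := by
  let _ : PartialOrder A := CStarAlgebra.spectralOrder A
  have _ : StarOrderedRing A := CStarAlgebra.spectralOrderedRing A
  refine ge_of_tendsto ξ.tendsto_norm ?_
  filter_upwards [eventually_ge_atTop {g}] with s hs
  refine Real.le_sqrt_of_sq_le ?_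
  rw [sq, ← CStarRing.norm_star_mul_self]
  refine CStarAlgebra.norm_le_norm_of_nonneg_of_le (star_mul_self_nonneg _) ?_
  exact Finset.single_le_sum (f := fun g => star (ξ g) * ξ g)
    (fun i _ => star_mul_self_nonneg _) (by simpa using hs)

theorem L2.normCore : NormedSpace.Core ℂ (L2 G A) where
  norm_nonneg _ := Real.sqrt_nonneg _
  norm_eq_zero_iff ξ := by
    constructor
    · intro h
      refine Subtype.ext (funext fun g => ?_)
      have := ξ.norm_apply_le g
      rw [h] at this
      exact norm_le_zero_iff.1 this
    · rintro rfl
      change √‖∑' _ : G, star (0 : A) * 0‖ = 0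
      simp
  norm_smul c ξ := by
    have : (fun g => star ((c • ξ : L2 G A) g) * (c • ξ : L2 G A) g) =
        fun g => (star c * c) • (star (ξ g) * ξ g) := by
      funext g
      change star (c • ξ g) * (c • ξ g) = _
      simp [smul_smul, mul_comm]
    rw [L2.norm_def, this, Summable.tsum_const_smul _ ξ.summable, norm_smul,
      CStarRing.norm_star_mul_self, Real.sqrt_mul (by positivity), Real.sqrt_mul_self (by positivity),
      L2.norm_def]
  norm_triangle ξ η :=
    le_of_tendsto_of_tendsto' (ξ + η).tendsto_norm (ξ.tendsto_norm.add η.tendsto_norm)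
      fun s => finset_triangle s ξ η

instance : NormedAddCommGroup (L2 G A) := NormedAddCommGroup.ofCore L2.normCore

instance : NormedSpace ℂ (L2 G A) := NormedSpace.ofCore L2.normCore

/-! ### Length functions and growth -/

/-- A proper length function on `G`. It induces the proper left-invariant metric
`d(x, y) = l(y⁻¹ x)`; left invariance is automatic from this formula. -/
structure ProperLength (G : Type*) [Group G] where
  toFun : G → ℝ
  eq_zero_iff' : ∀ g, toFun g = 0 ↔ g = 1
  inv' : ∀ g, toFun g⁻¹ = toFun g
  mul_le' : ∀ g h, toFun (g * h) ≤ toFun g + toFun h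
  finite_ball' : ∀ r : ℝ, {g | toFun g ≤ r}.Finite

instance (G : Type*) [Group G] : CoeFun (ProperLength G) (fun _ => G → ℝ) := ⟨ProperLength.toFun⟩

/-- The left-invariant metric `d(x, y) = l(y⁻¹ x)` induced by a length function. -/
def ProperLength.dist [Group G] (l : ProperLength G) (x y : G) : ℝ := l (y⁻¹ * x)

/-- The polynomial weight `u(r) = (1 + r)^a`. -/
def polyWeight (a r : ℝ) : ℝ := (1 + r) ^ a

/-- `G` has `u`-growth: the number of elements of the ball `B(e, r)` is less than `c u(r)^t` for
all radii `r ≥ 0`, with some constants `c, t > 0`. -/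
def HasGrowth [Group G] (l : ProperLength G) (u : ℝ → ℝ) : Prop :=
  ∃ c > 0, ∃ t > 0, ∀ r : ℝ, 0 ≤ r → (({g : G | l g ≤ r}.ncard : ℕ) : ℝ) < c * u r ^ t

/-! ### Matrices, the Roe algebra with coefficients, and the weighted algebras -/

/-- The bounded operator `T` on `ℓ²(G, A)` is given by the matrix `t`:
`(T ξ)(x) = ∑_y t(x, y) ξ(y)` for all `ξ` and `x`. -/
def Represents (T : L2 G A →L[ℂ] L2 G A) (t : G → G → A) : Prop :=
  ∀ (ξ : L2 G A) (x : G), HasSum (fun y => t x y * ξ y) (T ξ x)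

/-- The matrix `t` has finite propagation. -/
def FinitePropagation [Group G] (l : ProperLength G) (t : G → G → A) : Prop :=
  ∃ R : ℝ, ∀ x y, R < l.dist x y → t x y = 0

theorem FinitePropagation.finite [Group G] {l : ProperLength G} {t : G → G → A}
    (ht : FinitePropagation l t) (x : G) : {y | t x y ≠ 0}.Finite := by
  obtain ⟨R, hR⟩ := ht
  have h : ((fun g : G => x * g⁻¹) '' {g | l g ≤ R}).Finite := (l.finite_ball' R).image _
  refine h.subset fun y hy => ?_
  refine ⟨y⁻¹ * x, ?_, by simp⟩
  by_contra hlt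
  exact hy (hR x y (not_le.1 hlt))

variable (A) in
/-- The algebra `ℂ[G, A]` of all bounded operators on `ℓ²(G, A)` that are given by an `A`-valued
matrix of finite propagation. (Local compactness is automatic: as `A` is unital, an `A`-valued
matrix with finitely many nonzero entries is a compact operator of Hilbert `A`-modules.) -/
def preRoe [Group G] (l : ProperLength G) :
    Subalgebra ℂ (L2 G A →L[ℂ] L2 G A) where
  carrier := {T | ∃ t : G → G → A, FinitePropagation l t ∧ Represents T t}
  mul_mem' := by
    rintro S T ⟨s, hs, hS⟩ ⟨t, ht, hT⟩
    refine ⟨fun x z => ∑ y ∈ (hs.finite x).toFinset, s x y * t y z, ?_, ?_⟩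
    · obtain ⟨R, hR⟩ := hs
      obtain ⟨R', hR'⟩ := ht
      refine ⟨R + R', fun x z hxz => Finset.sum_eq_zero fun y _ => ?_⟩
      by_cases h1 : R < l.dist x y
      · rw [hR x y h1, zero_mul]
      · rw [hR' y z, mul_zero]
        have h2 := l.mul_le' (z⁻¹ * y) (y⁻¹ * x)
        have h3 : z⁻¹ * y * (y⁻¹ * x) = z⁻¹ * x := by group
        rw [h3] at h2
        simp only [ProperLength.dist] at *
        linarith
    · intro ξ x
      have h1 : S (T ξ) x = ∑ y ∈ (hs.finite x).toFinset, s x y * T ξ y := by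
        refine (hS (T ξ) x).unique (hasSum_sum_of_ne_finset_zero fun y hy => ?_)
        have : s x y = 0 := by simpa using hy
        rw [this, zero_mul]
      change HasSum _ (S (T ξ) x)
      rw [h1]
      simp only [Finset.sum_mul, mul_assoc]
      exact hasSum_sum fun y _ => (hT ξ y).mul_left _
  add_mem' := by
    rintro S T ⟨s, ⟨R, hR⟩, hS⟩ ⟨t, ⟨R', hR'⟩, hT⟩
    refine ⟨fun x y => s x y + t x y, ⟨max R R', fun x y h => ?_⟩, fun ξ x => ?_⟩
    · change s x y + t x y = 0
      rw [hR x y ((le_max_left _ _).trans_lt h), hR' x y ((le_max_right _ _).trans_lt h), add_zero]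
    · simp only [add_mul]
      exact (hS ξ x).add (hT ξ x)
  algebraMap_mem' := by
    classical
    intro c
    refine ⟨fun x y => if y = x then algebraMap ℂ A c else 0, ⟨0, fun x y h => ?_⟩, fun ξ x => ?_⟩
    · change (if y = x then algebraMap ℂ A c else 0) = 0
      rw [if_neg]
      rintro rfl
      have h1 : l (y⁻¹ * y) = 0 := by rw [l.eq_zero_iff']; group
      simp only [ProperLength.dist] at h
      linarith
    · have h1 : algebraMap ℂ (L2 G A →L[ℂ] L2 G A) c ξ x = algebraMap ℂ A c * ξ x := by
        rw [Algebra.algebraMap_eq_smul_one, ← Algebra.smul_def]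
        rfl
      rw [h1]
      have h2 := hasSum_single (f := fun y => (if y = x then algebraMap ℂ A c else 0) * ξ y) x
        (fun y hy => by rw [if_neg hy, zero_mul])
      simpa using h2

variable (A) in
/-- The Roe algebra `C*(G, A)` with coefficients in `A`: the closure of `ℂ[G, A]` in the operator
norm of `B(ℓ²(G, A))`. -/
def roeAlgebra [Group G] (l : ProperLength G) :
    Subalgebra ℂ (L2 G A →L[ℂ] L2 G A) :=
  (preRoe A l).topologicalClosure

/-- The weighted norm `‖t‖_a = (∑_γ (sup_{y⁻¹ x = γ} ‖t(x, y)‖)² (1 + l(γ))^{2a})^{1/2}` of a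
matrix, with values in `[0, ∞]`. -/
def weightedNorm [Group G] (l : ProperLength G) (a : ℝ) (t : G → G → A) : ℝ≥0∞ :=
  (∑' γ : G, (⨆ (x : G) (y : G) (_ : y⁻¹ * x = γ), ‖t x y‖ₑ) ^ 2 *
    ENNReal.ofReal (polyWeight a (l γ)) ^ 2) ^ (1 / 2 : ℝ)

variable (A) in
/-- `W_a(G, A)`: the `A`-valued matrices with finite weighted norm. -/
def weightedSpace [Group G] (l : ProperLength G) (a : ℝ) :
    Set (G → G → A) :=
  {t | weightedNorm l a t < ∞}

variable (A) in
/-- `W_a^∞(G, A)`, the intersection of all `W_a(G, A)`, `a ≥ 0`. -/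
def weightedSpaceInf [Group G] (l : ProperLength G) :
    Set (G → G → A) :=
  ⋂ (a : ℝ) (_ : 0 ≤ a), weightedSpace A l a

end

end RoeCoeff

/-!
The weighted `ℓ²` norms are traded for the weighted `ℓ¹` norms `oneNorm l a t = ∑ D(γ) (1 + l(γ))^a`,
where `D(γ)` is the supremum of the norms of the entries of `t` on the diagonal `y⁻¹ x = γ`. Because
of polynomial growth `∑ (1 + l)^(-m)` is finite for some `m`, so by Cauchy–Schwarz the two families
of norms are equivalent up to a shift of `a` by `m` (`weightedNorm_le_oneNorm`,
`exists_oneNorm_le`), and finiteness of all of them amounts to rapid decay of the entries away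
from the diagonal (`oneNorm_ne_top_of_decay` is the nontrivial direction). The `ℓ¹` norms are
submultiplicative (`oneNorm_mul_le`) and for `a = 0` dominate the operator norm, because a matrix
is the sum of its diagonals and a diagonal acts as a permutation followed by a bounded
multiplication (`exists_represents_of_tsum_diagSup`). This gives the operators, the algebra
structure and the continuity statements. Density holds because matrices of finite propagation
decay rapidly, and completeness because the weighted norms are lower semicontinuous for entrywise
convergence.

For inverse-closedness let `f` run through the bounded real functions on `G` that are
`1`-Lipschitz, and let `δ` be the commutator with multiplication by `f`. The matrix of `δ^k(T)` is
`(f(x) - f(y))^k t(x, y)`, so for `T` in the algebra `δ^k(T)` is bounded uniformly in `f`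
(`Represents.boundedCommutators`). From `δ(T⁻¹) = -T⁻¹ δ(T) T⁻¹` the same follows for `T⁻¹`
(`BoundedCommutators.inverse`). With `f` the distance to `z`, truncated at height `d(x, z)`, the
entry of `δ^k(T⁻¹)` at `(x, z)` is `d(x, z)^k` times the entry of `T⁻¹`, which therefore decays
rapidly (`Represents.inverse_decay`).
-/

namespace RoeCoeff

/-! ### Completeness and coordinates of the standard Hilbert module -/

section Module

variable {G A : Type*} [CStarAlgebra A]

/-- The Hilbert module norm of the restriction of `ξ` to a finite set. It makes sense for every
function, and membership in `ℓ²(G, A)` as well as norms there are tested on it. -/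
noncomputable def partialNorm (s : Finset G) (ξ : G → A) : ℝ :=
  √‖∑ g ∈ s, star (ξ g) * ξ g‖

theorem partialNorm_singleton (g : G) (ξ : G → A) : partialNorm {g} ξ = ‖ξ g‖ := by
  rw [partialNorm, Finset.sum_singleton, CStarRing.norm_star_mul_self,
    Real.sqrt_mul_self (norm_nonneg _)]

theorem partialNorm_add_le (s : Finset G) (ξ η : G → A) :
    partialNorm s (ξ + η) ≤ partialNorm s ξ + partialNorm s η :=
  finset_triangle s ξ η

theorem partialNorm_mono {s t : Finset G} (h : s ⊆ t) (ξ : G → A) :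
    partialNorm s ξ ≤ partialNorm t ξ := by
  let _ : PartialOrder A := CStarAlgebra.spectralOrder A
  have _ : StarOrderedRing A := CStarAlgebra.spectralOrderedRing A
  refine Real.sqrt_le_sqrt (CStarAlgebra.norm_le_norm_of_nonneg_of_le
    (Finset.sum_nonneg fun _ _ => star_mul_self_nonneg _) ?_)
  exact Finset.sum_le_sum_of_subset_of_nonneg h fun _ _ _ => star_mul_self_nonneg _

theorem partialNorm_congr {s : Finset G} {ξ η : G → A} (h : ∀ g ∈ s, ξ g = η g) :
    partialNorm s ξ = partialNorm s η := by
  unfold partialNorm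
  rw [Finset.sum_congr rfl fun g hg => by rw [h g hg]]

theorem partialNorm_filter [DecidableEq G] (s u : Finset G) (ξ : G → A) :
    partialNorm u (fun g => if g ∈ s then 0 else ξ g) = partialNorm (u \ s) ξ := by
  unfold partialNorm
  congr 2
  rw [Finset.sdiff_eq_filter, Finset.sum_filter]
  refine Finset.sum_congr rfl fun g _ => ?_
  by_cases h : g ∈ s <;> simp [h]

/-- Multiplication by a bounded function followed by a change of variables is bounded on finite
column modules, because `ξ* a* a ξ ≤ ‖a‖² ξ* ξ` in a C*-algebra. -/
theorem partialNorm_mul_comp_le {a : G → A} {C : ℝ} (hC : 0 ≤ C) (ha : ∀ x, ‖a x‖ ≤ C)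
    (σ : G ≃ G) (s : Finset G) (ξ : G → A) :
    partialNorm s (fun x => a x * ξ (σ x)) ≤ C * partialNorm (s.map σ.toEmbedding) ξ := by
  let _ : PartialOrder A := CStarAlgebra.spectralOrder A
  have _ : StarOrderedRing A := CStarAlgebra.spectralOrderedRing A
  have h1 : ∑ x ∈ s, star (a x * ξ (σ x)) * (a x * ξ (σ x)) ≤
      (C ^ 2) • ∑ x ∈ s, star (ξ (σ x)) * ξ (σ x) := by
    rw [Finset.smul_sum]
    refine Finset.sum_le_sum fun x _ => ?_
    have h2 := CStarAlgebra.star_left_conjugate_le_norm_smul (a := ξ (σ x))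
      (b := star (a x) * a x) (IsSelfAdjoint.star_mul_self _)
    rw [CStarRing.norm_star_mul_self] at h2
    calc star (a x * ξ (σ x)) * (a x * ξ (σ x))
        = star (ξ (σ x)) * (star (a x) * a x) * ξ (σ x) := by simp only [star_mul, mul_assoc]
      _ ≤ (‖a x‖ * ‖a x‖) • (star (ξ (σ x)) * ξ (σ x)) := h2
      _ ≤ (C ^ 2) • (star (ξ (σ x)) * ξ (σ x)) := by
        refine smul_le_smul_of_nonneg_right ?_ (star_mul_self_nonneg _)
        rw [sq]
        exact mul_self_le_mul_self (norm_nonneg _) (ha x)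
  have h3 := CStarAlgebra.norm_le_norm_of_nonneg_of_le
    (Finset.sum_nonneg fun _ _ => star_mul_self_nonneg _) h1
  rw [norm_smul, Real.norm_of_nonneg (by positivity)] at h3
  unfold partialNorm
  rw [Finset.sum_map]
  refine (Real.sqrt_le_sqrt h3).trans ?_
  rw [Real.sqrt_mul (by positivity), Real.sqrt_sq hC]
  rfl

theorem mem_l2Submodule_iff {ξ : G → A} : ξ ∈ l2Submodule G A ↔
    ∀ ε > 0, ∃ s : Finset G, ∀ u : Finset G, Disjoint u s → partialNorm u ξ < ε := by
  change Summable (fun g => star (ξ g) * ξ g) ↔ _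
  rw [summable_iff_vanishing_norm]
  constructor
  · intro h ε hε
    obtain ⟨s, hs⟩ := h (ε ^ 2) (by positivity)
    exact ⟨s, fun u hu => (Real.sqrt_lt' hε).2 (hs u hu)⟩
  · intro h ε hε
    obtain ⟨s, hs⟩ := h (√ε) (Real.sqrt_pos.2 hε)
    exact ⟨s, fun u hu => (Real.sqrt_lt_sqrt_iff (norm_nonneg _)).1 (hs u hu)⟩

namespace L2

theorem partialNorm_le_norm (s : Finset G) (ξ : L2 G A) : partialNorm s ξ ≤ ‖ξ‖ := by
  refine ge_of_tendsto ξ.tendsto_norm ?_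
  filter_upwards [eventually_ge_atTop s] with u hu
  exact partialNorm_mono hu _

theorem norm_le_of_partialNorm_le {ξ : L2 G A} {C : ℝ} (h : ∀ s, partialNorm s ξ ≤ C) :
    ‖ξ‖ ≤ C :=
  le_of_tendsto' ξ.tendsto_norm h

theorem vanishing (ξ : L2 G A) {ε : ℝ} (hε : 0 < ε) :
    ∃ s : Finset G, ∀ u : Finset G, Disjoint u s → partialNorm u ξ < ε :=
  mem_l2Submodule_iff.1 ξ.2 ε hε

@[ext]
theorem ext {ξ η : L2 G A} (h : ∀ g, ξ g = η g) : ξ = η := Subtype.ext (funext h)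

/-- The coordinate at `g` as a bounded operator `ℓ²(G, A) → A`. -/
noncomputable def eval (g : G) : L2 G A →L[ℂ] A :=
  LinearMap.mkContinuous
    { toFun := fun ξ => ξ g
      map_add' := fun _ _ => rfl
      map_smul' := fun _ _ => rfl } 1 fun ξ => by
      rw [one_mul]
      exact ξ.norm_apply_le g

@[simp]
theorem eval_apply (g : G) (ξ : L2 G A) : eval g ξ = ξ g := rfl

instance : CompleteSpace (L2 G A) := by
  refine Metric.complete_of_cauchySeq_tendsto fun u hu => ?_
  have h1 : ∀ g, ∃ a, Tendsto (fun n => u n g) atTop (𝓝 a) := fun g =>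
    cauchySeq_tendsto_of_complete (hu.map (eval g).uniformContinuous)
  choose ξ hξ using h1
  have h2 : ∀ ε > 0, ∃ N, ∀ n ≥ N, ∀ s : Finset G, partialNorm s (ξ - (u n).1) ≤ ε := by
    intro ε hε
    obtain ⟨N, hN⟩ := Metric.cauchySeq_iff.1 hu ε hε
    refine ⟨N, fun n hn s => ?_⟩
    have h3 : Tendsto (fun m => partialNorm s ((u m).1 - (u n).1)) atTop
        (𝓝 (partialNorm s (ξ - (u n).1))) := by
      refine (Real.continuous_sqrt.tendsto _).comp (Tendsto.norm (tendsto_finsetSum _ fun g _ => ?_))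
      have h4 : Tendsto (fun m => ((u m).1 - (u n).1) g) atTop (𝓝 ((ξ - (u n).1) g)) :=
        (hξ g).sub_const _
      exact h4.star.mul h4
    refine le_of_tendsto h3 ?_
    filter_upwards [eventually_ge_atTop N] with m hm
    have h5 := hN m hm n hn
    rw [dist_eq_norm] at h5
    exact (partialNorm_le_norm s (u m - u n)).trans h5.le
  have h6 : ξ ∈ l2Submodule G A := by
    rw [mem_l2Submodule_iff]
    intro ε hε
    obtain ⟨N, hN⟩ := h2 (ε / 2) (by positivity)
    obtain ⟨s, hs⟩ := (u N).vanishing (half_pos hε)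
    refine ⟨s, fun t ht => ?_⟩
    have h7 := partialNorm_add_le t (ξ - (u N).1) (u N).1
    rw [sub_add_cancel] at h7
    linarith [hN N le_rfl t, hs t ht]
  obtain ⟨ζ, hζ⟩ : ∃ ζ : L2 G A, ζ.1 = ξ := ⟨⟨ξ, h6⟩, rfl⟩
  refine ⟨ζ, Metric.tendsto_atTop.2 fun ε hε => ?_⟩
  obtain ⟨N, hN⟩ := h2 (ε / 2) (by positivity)
  refine ⟨N, fun n hn => ?_⟩
  rw [dist_comm, dist_eq_norm]
  refine (norm_le_of_partialNorm_le (ξ := ζ - u n) (C := ε / 2) fun s => ?_).trans_lt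
    (half_lt_self hε)
  have h7 := hN n hn s
  rw [← hζ] at h7
  exact h7

theorem single_mem [DecidableEq G] (g : G) (a : A) : Pi.single g a ∈ l2Submodule G A := by
  rw [mem_l2Submodule_iff]
  intro ε hε
  refine ⟨{g}, fun u hu => ?_⟩
  have h : partialNorm u (Pi.single g a) = partialNorm u (0 : G → A) :=
    partialNorm_congr fun x hx => by
      rw [Pi.single_eq_of_ne, Pi.zero_apply]
      rintro rfl
      simp [hx] at hu
  rw [h]
  simpa [partialNorm] using hε

open scoped Classical in
/-- The element of `ℓ²(G, A)` with value `a` at `g` and `0` elsewhere. -/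
noncomputable def single (g : G) (a : A) : L2 G A := ⟨Pi.single g a, single_mem g a⟩

@[simp]
theorem single_same (g : G) (a : A) : single g a g = a := by
  classical exact Pi.single_eq_same (M := fun _ => A) g a

theorem single_of_ne {g x : G} (h : x ≠ g) (a : A) : single g a x = 0 := by
  classical exact Pi.single_eq_of_ne (M := fun _ => A) h a

theorem norm_single_le (g : G) (a : A) : ‖single g a‖ ≤ ‖a‖ := by
  classical
  refine norm_le_of_partialNorm_le fun s => ?_
  have h1 := partialNorm_filter {g} s (single g a)
  by_cases hg : g ∈ s
  · have h2 : partialNorm s (single g a) = partialNorm {g} (single g a) := by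
      unfold partialNorm
      congr 2
      refine (Finset.sum_subset (by simpa using hg) fun x _ hx => ?_).symm
      rw [single_of_ne (by simpa using hx), mul_zero]
    rw [h2, partialNorm_singleton, single_same]
  · have h2 : partialNorm s (single g a) = partialNorm s (0 : G → A) :=
      partialNorm_congr fun x hx => single_of_ne (by rintro rfl; exact hg hx) _
    rw [h2]
    simp [partialNorm]

theorem hasSum_single (ξ : L2 G A) : HasSum (fun g => single g (ξ g)) ξ := by
  classical
  refine Metric.tendsto_atTop.2 fun ε hε => ?_
  obtain ⟨s, hs⟩ := ξ.vanishing (half_pos hε)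
  refine ⟨s, fun t ht => ?_⟩
  rw [dist_comm, dist_eq_norm]
  refine lt_of_le_of_lt (norm_le_of_partialNorm_le fun u => ?_) (half_lt_self hε)
  have h1 : ∀ x, (ξ - ∑ g ∈ t, single g (ξ g)) x = if x ∈ t then 0 else ξ x := by
    intro x
    rw [← eval_apply, map_sub, map_sum]
    simp only [eval_apply]
    split_ifs with hx
    · rw [Finset.sum_eq_single_of_mem x hx fun g _ hg => single_of_ne hg.symm _, single_same,
        sub_self]
    · rw [Finset.sum_eq_zero, sub_zero]
      intro g hg
      exact single_of_ne (by rintro rfl; exact hx hg) _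
  rw [partialNorm_congr fun x _ => h1 x, partialNorm_filter]
  exact (hs _ (Finset.disjoint_of_subset_right ht Finset.sdiff_disjoint)).le

/-- The right action of the coefficient algebra on `ℓ²(G, A)`. -/
def rmul (ξ : L2 G A) (a : A) : L2 G A :=
  ⟨fun g => ξ g * a, by
    have h : (fun g => star (ξ g * a) * (ξ g * a)) =
        fun g => star a * (star (ξ g) * ξ g) * a := by
      funext g
      simp only [star_mul, mul_assoc]
    change Summable fun g => star (ξ g * a) * (ξ g * a)
    rw [h]
    exact (ξ.summable.mul_left _).mul_right _⟩

@[simp]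
theorem rmul_apply (ξ : L2 G A) (a : A) (g : G) : ξ.rmul a g = ξ g * a := rfl

theorem rmul_single (g : G) (a b : A) : (single g a).rmul b = single g (a * b) := by
  ext x
  rw [rmul_apply]
  by_cases h : x = g
  · rw [h, single_same, single_same]
  · rw [single_of_ne h, single_of_ne h, zero_mul]

end L2

theorem mul_comp_mem {a : G → A} {C : ℝ} (ha : ∀ x, ‖a x‖ ≤ C) (σ : G ≃ G) (ξ : L2 G A) :
    (fun x => a x * ξ (σ x)) ∈ l2Submodule G A := by
  classical
  rw [mem_l2Submodule_iff]
  intro ε hε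
  have hC : 0 < max C 1 := lt_max_of_lt_right one_pos
  obtain ⟨s, hs⟩ := ξ.vanishing (div_pos hε hC)
  refine ⟨s.map σ.symm.toEmbedding, fun u hu => ?_⟩
  refine (partialNorm_mul_comp_le hC.le (fun x => (ha x).trans (le_max_left _ _)) σ u ξ).trans_lt ?_
  have h1 : Disjoint (u.map σ.toEmbedding) s := by
    rw [Finset.disjoint_left] at hu ⊢
    intro x hx hxs
    obtain ⟨y, hy, rfl⟩ := Finset.mem_map.1 hx
    exact hu hy (Finset.mem_map.2 ⟨_, hxs, by simp⟩)
  have h2 := hs _ h1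
  rw [lt_div_iff₀ hC] at h2
  linarith

/-- The operator `(T ξ)(x) = a(x) ξ(σ x)`, for a bounded function `a` and a permutation `σ`. A
matrix is a sum of such operators, one for each diagonal. -/
noncomputable def diagOp (a : G → A) (C : ℝ) (ha : ∀ x, ‖a x‖ ≤ C) (σ : G ≃ G) :
    L2 G A →L[ℂ] L2 G A :=
  LinearMap.mkContinuous
    { toFun := fun ξ => ⟨fun x => a x * ξ (σ x), mul_comp_mem ha σ ξ⟩
      map_add' := fun _ _ => L2.ext fun _ => mul_add _ _ _
      map_smul' := fun _ _ => L2.ext fun _ => mul_smul_comm _ _ _ }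
    (max C 0) fun ξ => L2.norm_le_of_partialNorm_le fun s =>
      (partialNorm_mul_comp_le (le_max_right _ _) (fun x => (ha x).trans (le_max_left _ _)) σ s
        ξ).trans (mul_le_mul_of_nonneg_left (L2.partialNorm_le_norm _ _) (le_max_right _ _))

theorem norm_diagOp_le {a : G → A} {C : ℝ} (hC : 0 ≤ C) (ha : ∀ x, ‖a x‖ ≤ C) (σ : G ≃ G) :
    ‖diagOp a C ha σ‖ ≤ C :=
  (LinearMap.mkContinuous_norm_le _ (le_max_right _ _) _).trans (max_le le_rfl hC)

end Module

/-! ### Operators given by matrices -/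

section Matrices

variable {G A : Type*} [CStarAlgebra A]

theorem norm_one_le_one : ‖(1 : A)‖ ≤ 1 := by
  cases subsingleton_or_nontrivial A
  · rw [Subsingleton.elim (1 : A) 0, norm_zero]
    exact zero_le_one
  · exact CStarRing.norm_one.le

namespace Represents

variable {S T : L2 G A →L[ℂ] L2 G A} {s t : G → G → A}

theorem apply_single (hT : Represents T t) (x y : G) (a : A) :
    T (L2.single y a) x = t x y * a := by
  refine (hT _ x).unique ?_
  convert _root_.hasSum_single (f := fun z => t x z * L2.single y a z) y fun z hz => ?_ using 1
  · rw [L2.single_same]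
  · rw [L2.single_of_ne hz, mul_zero]

theorem matrix_apply (hT : Represents T t) (x y : G) : t x y = T (L2.single y 1) x := by
  rw [hT.apply_single, mul_one]

theorem operator_unique (hS : Represents S t) (hT : Represents T t) : S = T :=
  ContinuousLinearMap.ext fun ξ => L2.ext fun x => (hS ξ x).unique (hT ξ x)

theorem norm_matrix_le (hT : Represents T t) (x y : G) : ‖t x y‖ ≤ ‖T‖ := by
  rw [hT.matrix_apply]
  refine ((T (L2.single y 1)).norm_apply_le x).trans ((T.le_opNorm _).trans ?_)
  exact mul_le_of_le_one_right (norm_nonneg _) ((L2.norm_single_le _ _).trans norm_one_le_one)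

theorem map_rmul (hT : Represents T t) (ξ : L2 G A) (a : A) :
    T (ξ.rmul a) = (T ξ).rmul a := by
  refine L2.ext fun x => (hT _ x).unique ?_
  simp only [L2.rmul_apply, ← mul_assoc]
  exact (hT ξ x).mul_right a

/-- A bounded operator that commutes with the right action of `A` is given by a matrix. -/
theorem of_map_rmul (hT : ∀ (ξ : L2 G A) (a : A), T (ξ.rmul a) = (T ξ).rmul a) :
    Represents T fun x y => T (L2.single y 1) x := by
  intro ξ x
  have h := ((L2.eval x).comp T).hasSum ξ.hasSum_single
  change HasSum _ ((L2.eval x ∘SL T) ξ)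
  convert h using 2 with y
  change T (L2.single y 1) x * ξ y = T (L2.single y (ξ y)) x
  rw [← L2.rmul_apply, ← hT, L2.rmul_single, one_mul]

theorem hasSum_mul (hS : Represents S s) (hT : Represents T t) {r : G → G → A}
    (hr : Represents (S * T) r) (x z : G) : HasSum (fun y => s x y * t y z) (r x z) := by
  have h := hS (T (L2.single z 1)) x
  simp only [← hT.matrix_apply] at h
  rw [hr.matrix_apply]
  exact h

theorem mul (hS : Represents S s) (hT : Represents T t) :
    Represents (S * T) fun x y => (S * T) (L2.single y 1) x := by
  refine of_map_rmul fun ξ a => ?_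
  change S (T (ξ.rmul a)) = (S (T ξ)).rmul a
  rw [hT.map_rmul, hS.map_rmul]

theorem add (hS : Represents S s) (hT : Represents T t) : Represents (S + T) (s + t) := by
  intro ξ x
  simp only [Pi.add_apply, add_mul]
  exact (hS ξ x).add (hT ξ x)

/-- The inverse of an operator given by a matrix is given by a matrix. -/
theorem of_mul_eq_one (hT : Represents T t) (h1 : T * S = 1) (h2 : S * T = 1) :
    Represents S fun x y => S (L2.single y 1) x := by
  have h1' : ∀ ξ, T (S ξ) = ξ := fun ξ => congrArg (fun U : L2 G A →L[ℂ] L2 G A => U ξ) h1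
  have h2' : ∀ ξ, S (T ξ) = ξ := fun ξ => congrArg (fun U : L2 G A →L[ℂ] L2 G A => U ξ) h2
  refine of_map_rmul fun ξ a => ?_
  conv_lhs => rw [← h1' ξ, ← hT.map_rmul, h2']

end Represents

end Matrices

/-! ### Convergence of the sum of the diagonals -/

section Diagonals

variable {G A : Type*} [Group G] [CStarAlgebra A]

/-- The supremum of the norms of the entries of a matrix on the diagonal `y⁻¹ x = γ`. -/
noncomputable def diagSup (t : G → G → A) (γ : G) : ℝ≥0∞ :=
  ⨆ (x : G) (y : G) (_ : y⁻¹ * x = γ), ‖t x y‖ₑ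

theorem enorm_le_diagSup (t : G → G → A) (x y : G) : ‖t x y‖ₑ ≤ diagSup t (y⁻¹ * x) :=
  le_iSup_of_le x (le_iSup_of_le y (le_iSup_of_le rfl le_rfl))

theorem diagSup_le {t : G → G → A} {γ : G} {C : ℝ≥0∞}
    (h : ∀ x y, y⁻¹ * x = γ → ‖t x y‖ₑ ≤ C) : diagSup t γ ≤ C :=
  iSup_le fun x => iSup_le fun y => iSup_le fun hxy => h x y hxy

/-- A matrix with summable diagonal suprema gives an operator whose norm is at most the sum, because
each diagonal is a permutation followed by multiplication with a bounded function. The operator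
is the norm limit of sums of finitely many diagonals, so it lies in the Roe algebra. -/
theorem exists_represents_of_tsum_diagSup (l : ProperLength G) {t : G → G → A}
    (ht : ∑' γ, diagSup t γ ≠ ∞) :
    ∃ T ∈ roeAlgebra A l, Represents T t ∧ ‖T‖ₑ ≤ ∑' γ, diagSup t γ := by
  classical
  have hfin : ∀ γ, diagSup t γ ≠ ∞ := ENNReal.ne_top_of_tsum_ne_top ht
  have hb : ∀ γ x, ‖t x (x * γ⁻¹)‖ ≤ (diagSup t γ).toReal := by
    intro γ x
    have h1 := enorm_le_diagSup t x (x * γ⁻¹)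
    have h2 : (x * γ⁻¹)⁻¹ * x = γ := by group
    rw [h2] at h1
    have h3 := ENNReal.toReal_mono (hfin γ) h1
    rwa [toReal_enorm] at h3
  let D : G → L2 G A →L[ℂ] L2 G A := fun γ =>
    diagOp (fun x => t x (x * γ⁻¹)) _ (hb γ) (Equiv.mulRight γ⁻¹)
  have hD : ∀ γ, ‖D γ‖ ≤ (diagSup t γ).toReal := fun γ =>
    norm_diagOp_le ENNReal.toReal_nonneg _ _
  have hs := ENNReal.summable_toReal ht
  have hsum : HasSum D (∑' γ, D γ) := (hs.of_norm_bounded hD).hasSum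
  refine ⟨∑' γ, D γ, ?_, fun ξ x => ?_, ?_⟩
  · change _ ∈ ((preRoe A l).topologicalClosure : Set (L2 G A →L[ℂ] L2 G A))
    rw [Subalgebra.topologicalClosure_coe]
    refine mem_closure_of_tendsto hsum (Eventually.of_forall fun F => ?_)
    refine (preRoe A l).sum_mem fun γ _ => ?_
    refine ⟨fun x y => if y = x * γ⁻¹ then t x y else 0, ⟨l γ, fun x y hxy => ?_⟩,
      fun ξ x => ?_⟩
    · change (if y = x * γ⁻¹ then t x y else 0) = 0
      rw [if_neg]
      rintro rfl
      have h2 : (x * γ⁻¹)⁻¹ * x = γ := by group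
      rw [ProperLength.dist, h2] at hxy
      exact lt_irrefl _ hxy
    · convert hasSum_single (x * γ⁻¹) fun y hy => ?_ using 1
      · change t x (x * γ⁻¹) * ξ (x * γ⁻¹) =
          (if x * γ⁻¹ = x * γ⁻¹ then t x (x * γ⁻¹) else 0) * ξ (x * γ⁻¹)
        rw [if_pos rfl]
      · change (if y = x * γ⁻¹ then t x y else 0) * ξ y = 0
        rw [if_neg hy, zero_mul]
  · have h1 := ((L2.eval x).comp (ContinuousLinearMap.apply ℂ (L2 G A) ξ)).hasSum hsum
    have h2 : (fun γ => ((L2.eval x).comp (ContinuousLinearMap.apply ℂ (L2 G A) ξ)) (D γ)) =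
        (fun y => t x y * ξ y) ∘ ((Equiv.inv G).trans (Equiv.mulLeft x)) := rfl
    rw [h2, Equiv.hasSum_iff] at h1
    exact h1
  · have h1 : ‖∑' γ, D γ‖ ≤ ∑' γ, (diagSup t γ).toReal := tsum_of_norm_bounded hs.hasSum hD
    rw [← ofReal_norm]
    refine (ENNReal.ofReal_le_ofReal h1).trans ?_
    rw [ENNReal.ofReal_tsum_of_nonneg (fun _ => ENNReal.toReal_nonneg) hs]
    exact ENNReal.tsum_le_tsum fun γ => ENNReal.ofReal_toReal_le

theorem Represents.enorm_le_tsum_diagSup (l : ProperLength G) {T : L2 G A →L[ℂ] L2 G A}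
    {t : G → G → A} (hT : Represents T t) : ‖T‖ₑ ≤ ∑' γ, diagSup t γ := by
  by_cases ht : ∑' γ, diagSup t γ = ∞
  · rw [ht]
    exact le_top
  · obtain ⟨S, -, hS, h⟩ := exists_represents_of_tsum_diagSup l ht
    rwa [hT.operator_unique hS]

end Diagonals

/-! ### Polynomial weights -/

section Weights

variable {G : Type*} [Group G] (l : ProperLength G)

theorem ProperLength.nonneg (g : G) : 0 ≤ l g := by
  have h := l.mul_le' g g⁻¹
  rw [mul_inv_cancel, (l.eq_zero_iff' 1).2 rfl, l.inv'] at h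
  linarith

/-- The weight `(1 + l(γ))^a` as an extended nonnegative real number. -/
noncomputable def weight (a : ℝ) (γ : G) : ℝ≥0∞ := ENNReal.ofReal (polyWeight a (l γ))

theorem weight_zero (γ : G) : weight l 0 γ = 1 := by simp [weight, polyWeight]

theorem weight_add (a b : ℝ) (γ : G) : weight l (a + b) γ = weight l a γ * weight l b γ := by
  have h := l.nonneg γ
  rw [weight, weight, weight, polyWeight, Real.rpow_add (by linarith),
    ENNReal.ofReal_mul (Real.rpow_nonneg (by linarith) _)]
  rfl

theorem weight_mono {a b : ℝ} (h : a ≤ b) (γ : G) : weight l a γ ≤ weight l b γ :=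
  ENNReal.ofReal_le_ofReal
    (Real.rpow_le_rpow_of_exponent_le (by linarith [l.nonneg γ]) h)

theorem weight_mul_le {a : ℝ} (ha : 0 ≤ a) (g h : G) :
    weight l a (g * h) ≤ weight l a g * weight l a h := by
  have h1 := l.nonneg g
  have h2 := l.nonneg h
  have h3 := l.nonneg (g * h)
  have h4 := l.mul_le' g h
  rw [weight, weight, weight, polyWeight, polyWeight, polyWeight,
    ← ENNReal.ofReal_mul (Real.rpow_nonneg (by linarith) _),
    ← Real.mul_rpow (by linarith) (by linarith)]
  refine ENNReal.ofReal_le_ofReal (Real.rpow_le_rpow (by linarith) ?_ ha)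
  nlinarith

theorem weight_natCast (k : ℕ) (γ : G) : weight l k γ = ENNReal.ofReal ((1 + l γ) ^ k) := by
  rw [weight, polyWeight, Real.rpow_natCast]

/-- Polynomial growth makes `(1 + l)^(-m)` summable over the group for large `m`: there are at most
`c (n + 2)^p` elements of length between `n` and `n + 1`. -/
theorem HasGrowth.exists_tsum_weight_ne_top {l : ProperLength G} {a₀ : ℝ} (ha₀ : 0 < a₀)
    (hG : HasGrowth l (polyWeight a₀)) : ∃ m : ℝ, 0 ≤ m ∧ ∑' γ, weight l (-m) γ ≠ ∞ := by
  classical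
  obtain ⟨c, hc, s, hs, hcard⟩ := hG
  set p := a₀ * s with hp
  have hp0 : 0 < p := mul_pos ha₀ (Nat.cast_pos.2 hs)
  refine ⟨p + 2, by linarith, ?_⟩
  let q : ℕ → ℝ≥0∞ := fun n => ENNReal.ofReal ((1 + n : ℝ) ^ (-(p + 2)))
  have h1 : ∀ γ, weight l (-(p + 2)) γ ≤ ∑' n : ℕ, if l γ ≤ n + 1 then q n else 0 := by
    intro γ
    have h0 := l.nonneg γ
    refine le_trans ?_ (ENNReal.le_tsum ⌊l γ⌋₊)
    rw [if_pos (Nat.lt_floor_add_one _).le]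
    refine ENNReal.ofReal_le_ofReal (Real.rpow_le_rpow_of_nonpos (by positivity) ?_ (by linarith))
    linarith [Nat.floor_le h0]
  have h2 : ∀ n : ℕ, (∑' γ : G, if l γ ≤ n + 1 then q n else 0) ≤
      ENNReal.ofReal (c * 2 ^ p * (1 / ((n + 1 : ℕ) : ℝ) ^ (2 : ℝ))) := by
    intro n
    have hf := l.finite_ball' (n + 1)
    have h3 := hcard (n + 1) (by positivity)
    rw [Set.ncard_eq_toFinset_card _ hf, polyWeight, ← Real.rpow_mul_natCast (by positivity),
      ← hp] at h3
    rw [tsum_eq_sum (s := hf.toFinset) fun γ hγ => if_neg (by simpa using hγ),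
      Finset.sum_congr rfl fun γ hγ => if_pos (by simpa using hγ), Finset.sum_const, nsmul_eq_mul,
      ← ENNReal.ofReal_natCast, ← ENNReal.ofReal_mul (by positivity)]
    refine ENNReal.ofReal_le_ofReal ?_
    have h4 : (1 + (n + 1 : ℝ)) ^ p ≤ 2 ^ p * (1 + n : ℝ) ^ p := by
      rw [← Real.mul_rpow (by positivity) (by positivity)]
      exact Real.rpow_le_rpow (by positivity) (by linarith) hp0.le
    calc _ ≤ c * (2 ^ p * (1 + n : ℝ) ^ p) * (1 + n : ℝ) ^ (-(p + 2)) := by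
          refine mul_le_mul_of_nonneg_right (h3.le.trans ?_) (by positivity)
          exact mul_le_mul_of_nonneg_left h4 hc.le
      _ = c * 2 ^ p * ((1 + n : ℝ) ^ p * (1 + n : ℝ) ^ (-(p + 2))) := by ring
      _ = _ := by
          rw [← Real.rpow_add (by positivity), show p + -(p + 2) = -2 by ring,
            Real.rpow_neg (by positivity), one_div]
          push_cast
          rw [add_comm (1 : ℝ)]
  have h5 : Summable fun n : ℕ => c * 2 ^ p * (1 / ((n + 1 : ℕ) : ℝ) ^ (2 : ℝ)) :=
    ((summable_nat_add_iff 1).2 (Real.summable_one_div_nat_rpow.2 one_lt_two)).mul_left _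
  refine ne_top_of_le_ne_top h5.tsum_ofReal_ne_top ?_
  calc ∑' γ, weight l (-(p + 2)) γ
      ≤ ∑' γ : G, ∑' n : ℕ, (if l γ ≤ n + 1 then q n else 0) := ENNReal.tsum_le_tsum h1
    _ = ∑' n : ℕ, ∑' γ : G, (if l γ ≤ n + 1 then q n else 0) := ENNReal.tsum_comm
    _ ≤ _ := ENNReal.tsum_le_tsum h2

end Weights

/-- The Cauchy–Schwarz inequality for series with values in `[0, ∞]`. -/
theorem tsum_mul_le_sqrt_mul_sqrt {ι : Type*} (f g : ι → ℝ≥0∞) :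
    ∑' i, f i * g i ≤ (∑' i, f i ^ 2) ^ (1 / 2 : ℝ) * (∑' i, g i ^ 2) ^ (1 / 2 : ℝ) := by
  rw [ENNReal.tsum_eq_iSup_sum]
  refine iSup_le fun s => ?_
  refine (ENNReal.inner_le_Lp_mul_Lq s f g Real.HolderConjugate.two_two).trans ?_
  simp only [ENNReal.rpow_two]
  gcongr
  · exact ENNReal.sum_le_tsum s
  · exact ENNReal.sum_le_tsum s

/-! ### Weighted norms of matrices -/

section Norms

variable {G A : Type*} [Group G] [CStarAlgebra A] (l : ProperLength G)

/-- The `ℓ¹` analogue of the weighted norm: the weighted sum of the diagonal suprema. Under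
polynomial growth these norms define the same topology as the weighted `ℓ²` norms, and they are
submultiplicative. -/
noncomputable def oneNorm (a : ℝ) (t : G → G → A) : ℝ≥0∞ := ∑' γ, diagSup t γ * weight l a γ

theorem oneNorm_zero (t : G → G → A) : oneNorm l 0 t = ∑' γ, diagSup t γ := by
  simp only [oneNorm, weight_zero, mul_one]

theorem weightedNorm_eq (a : ℝ) (t : G → G → A) :
    weightedNorm l a t = (∑' γ, (diagSup t γ * weight l a γ) ^ 2) ^ (1 / 2 : ℝ) := by
  simp only [mul_pow]
  rfl

theorem weightedNorm_le_oneNorm (a : ℝ) (t : G → G → A) : weightedNorm l a t ≤ oneNorm l a t := by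
  rw [weightedNorm_eq]
  have h : ∑' γ, (diagSup t γ * weight l a γ) ^ 2 ≤ oneNorm l a t ^ 2 := by
    rw [sq (oneNorm l a t)]
    conv_rhs => rw [oneNorm, ← ENNReal.tsum_mul_right]
    refine ENNReal.tsum_le_tsum fun γ => ?_
    rw [sq]
    exact mul_le_mul_right (ENNReal.le_tsum γ) _
  refine (ENNReal.rpow_le_rpow h (by norm_num)).trans_eq ?_
  rw [← ENNReal.rpow_two, ← ENNReal.rpow_mul]
  norm_num

variable {l}

theorem exists_oneNorm_le {m : ℝ} (hm0 : 0 ≤ m) (hm : ∑' γ, weight l (-m) γ ≠ ∞) :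
    ∃ C : ℝ≥0, ∀ (a : ℝ) (t : G → G → A), oneNorm l a t ≤ C * weightedNorm l (a + m) t := by
  have h1 : (∑' γ, weight l (-m) γ ^ 2) ^ (1 / 2 : ℝ) ≠ ∞ := by
    refine ENNReal.rpow_ne_top_of_nonneg (by norm_num) (ne_top_of_le_ne_top hm ?_)
    refine ENNReal.tsum_le_tsum fun γ => ?_
    rw [sq]
    refine mul_le_of_le_one_left' ?_
    rw [← weight_zero l γ]
    exact weight_mono l (by linarith) γ
  refine ⟨((∑' γ, weight l (-m) γ ^ 2) ^ (1 / 2 : ℝ)).toNNReal, fun a t => ?_⟩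
  rw [ENNReal.coe_toNNReal h1, mul_comm, weightedNorm_eq]
  refine le_trans (le_of_eq ?_) (tsum_mul_le_sqrt_mul_sqrt _ _)
  refine tsum_congr fun γ => ?_
  rw [mul_assoc, ← weight_add, add_neg_cancel_right]

theorem mem_weightedSpaceInf_iff {m : ℝ} (hm0 : 0 ≤ m) (hm : ∑' γ, weight l (-m) γ ≠ ∞)
    {t : G → G → A} : t ∈ weightedSpaceInf A l ↔ ∀ a : ℝ, 0 ≤ a → oneNorm l a t ≠ ∞ := by
  have h0 : t ∈ weightedSpaceInf A l ↔ ∀ a : ℝ, 0 ≤ a → weightedNorm l a t < ∞ := by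
    simp only [weightedSpaceInf, Set.mem_iInter]
    rfl
  rw [h0]
  obtain ⟨C, hC⟩ := exists_oneNorm_le (A := A) hm0 hm
  constructor
  · intro h a ha
    exact ne_top_of_le_ne_top (ENNReal.mul_ne_top ENNReal.coe_ne_top (h (a + m) (by linarith)).ne)
      (hC a t)
  · intro h a ha
    exact (weightedNorm_le_oneNorm l a t).trans_lt (h a ha).lt_top

theorem oneNorm_le_add {a : ℝ} {r s t : G → G → A}
    (h : ∀ x y, ‖r x y‖ₑ ≤ ‖s x y‖ₑ + ‖t x y‖ₑ) :
    oneNorm l a r ≤ oneNorm l a s + oneNorm l a t := by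
  rw [oneNorm, oneNorm, oneNorm, ← ENNReal.tsum_add]
  refine ENNReal.tsum_le_tsum fun γ => ?_
  rw [← add_mul]
  refine mul_le_mul_left (diagSup_le ?_) _
  rintro x y rfl
  exact (h x y).trans (add_le_add (enorm_le_diagSup s x y) (enorm_le_diagSup t x y))

/-- The weighted `ℓ¹` norms are submultiplicative: the diagonal suprema of a product of matrices
are dominated by the convolution of the diagonal suprema of the factors. -/
theorem oneNorm_mul_le {a : ℝ} (ha : 0 ≤ a) {r s t : G → G → A}
    (h : ∀ x z, HasSum (fun y => s x y * t y z) (r x z)) :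
    oneNorm l a r ≤ oneNorm l a s * oneNorm l a t := by
  have h1 : ∀ γ, diagSup r γ ≤ ∑' β, diagSup s (β⁻¹ * γ) * diagSup t β := by
    refine fun γ => diagSup_le ?_
    rintro x z rfl
    rw [← (h x z).tsum_eq]
    refine (enorm_tsum_le_tsum_enorm).trans ?_
    rw [← (Equiv.mulLeft z).tsum_eq]
    refine ENNReal.tsum_le_tsum fun β => ?_
    have h2 : ‖s x (z * β) * t (z * β) z‖ₑ ≤ ‖s x (z * β)‖ₑ * ‖t (z * β) z‖ₑ := by
      simp only [enorm_eq_nnnorm]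
      exact_mod_cast nnnorm_mul_le _ _
    refine h2.trans (mul_le_mul' ?_ ?_)
    · refine (enorm_le_diagSup s x (z * β)).trans_eq (congrArg _ ?_)
      rw [mul_inv_rev]
      exact mul_assoc _ _ _
    · exact (enorm_le_diagSup t (z * β) z).trans_eq (congrArg _ (inv_mul_cancel_left z β))
  calc oneNorm l a r
      ≤ ∑' γ, ∑' β, (diagSup s (β⁻¹ * γ) * weight l a (β⁻¹ * γ)) *
          (diagSup t β * weight l a β) := by
        refine ENNReal.tsum_le_tsum fun γ => ?_
        refine (mul_le_mul_left (h1 γ) _).trans ?_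
        rw [← ENNReal.tsum_mul_right]
        refine ENNReal.tsum_le_tsum fun β => ?_
        have h2 := weight_mul_le l ha β (β⁻¹ * γ)
        rw [mul_inv_cancel_left] at h2
        refine (mul_le_mul_right h2 _).trans_eq ?_
        ring
    _ = ∑' β, ∑' γ, (diagSup s (β⁻¹ * γ) * weight l a (β⁻¹ * γ)) *
          (diagSup t β * weight l a β) := ENNReal.tsum_comm
    _ = ∑' β, oneNorm l a s * (diagSup t β * weight l a β) := by
        refine tsum_congr fun β => ?_
        rw [ENNReal.tsum_mul_right]
        congr 1
        exact (Equiv.mulLeft β⁻¹).tsum_eq fun γ => diagSup s γ * weight l a γ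
    _ = _ := ENNReal.tsum_mul_left

/-- Under polynomial growth, rapid decay of the entries away from the diagonal makes all weighted
`ℓ¹` norms finite. -/
theorem oneNorm_ne_top_of_decay {m : ℝ} (hm : ∑' γ, weight l (-m) γ ≠ ∞) {t : G → G → A}
    (h : ∀ k : ℕ, ∃ C : ℝ, ∀ x y, ‖t x y‖ * l.dist x y ^ k ≤ C) (a : ℝ) :
    oneNorm l a t ≠ ∞ := by
  obtain ⟨k, hk⟩ := exists_nat_ge (a + m)
  obtain ⟨C₀, h₀⟩ := h 0
  obtain ⟨C₁, h₁⟩ := h k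
  have h2 : ∀ γ, diagSup t γ * weight l k γ ≤ ENNReal.ofReal (2 ^ (k - 1) * (C₀ + C₁)) := by
    intro γ
    have h3 := l.nonneg γ
    rw [weight_natCast, diagSup]
    simp only [ENNReal.iSup_mul]
    refine iSup_le fun x => iSup_le fun y => iSup_le fun hxy => ?_
    rw [← ofReal_norm, ← ENNReal.ofReal_mul (norm_nonneg _)]
    refine ENNReal.ofReal_le_ofReal ?_
    have h4 := add_pow_le zero_le_one h3 k
    have h5 := h₀ x y
    have h6 := h₁ x y
    rw [ProperLength.dist, hxy] at h5 h6
    calc ‖t x y‖ * (1 + l γ) ^ k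
        ≤ ‖t x y‖ * (2 ^ (k - 1) * (1 ^ k + l γ ^ k)) :=
          mul_le_mul_of_nonneg_left h4 (norm_nonneg _)
      _ = 2 ^ (k - 1) * (‖t x y‖ * l γ ^ 0 + ‖t x y‖ * l γ ^ k) := by rw [one_pow, pow_zero]; ring
      _ ≤ _ := mul_le_mul_of_nonneg_left (add_le_add h5 h6) (by positivity)
  refine ne_top_of_le_ne_top (ENNReal.mul_ne_top (ENNReal.ofReal_ne_top (r := _)) hm)
    (?_ : _ ≤ ENNReal.ofReal (2 ^ (k - 1) * (C₀ + C₁)) * ∑' γ, weight l (-m) γ)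
  rw [← ENNReal.tsum_mul_left]
  refine ENNReal.tsum_le_tsum fun γ => ?_
  calc diagSup t γ * weight l a γ
      ≤ diagSup t γ * weight l (k + -m) γ :=
        mul_le_mul_right (weight_mono l (by linarith) γ) _
    _ = diagSup t γ * weight l k γ * weight l (-m) γ := by rw [weight_add, mul_assoc]
    _ ≤ _ := mul_le_mul_left (h2 γ) _

/-! ### Completeness of the weighted spaces -/

theorem enorm_le_weightedNorm {a : ℝ} (ha : 0 ≤ a) (t : G → G → A) (x y : G) :
    ‖t x y‖ₑ ≤ weightedNorm l a t := by
  have h1 : (diagSup t (y⁻¹ * x) * weight l a (y⁻¹ * x)) ^ 2 ≤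
      ∑' γ, (diagSup t γ * weight l a γ) ^ 2 := ENNReal.le_tsum _
  have h2 := ENNReal.rpow_le_rpow h1 (show (0 : ℝ) ≤ 1 / 2 by norm_num)
  rw [← weightedNorm_eq, ← ENNReal.rpow_two, ← ENNReal.rpow_mul] at h2
  norm_num at h2
  refine ((enorm_le_diagSup t x y).trans (le_mul_of_one_le_right' ?_)).trans h2
  rw [← weight_zero l (y⁻¹ * x)]
  exact weight_mono l ha _

theorem lowerSemicontinuous_weightedNorm (a : ℝ) :
    LowerSemicontinuous fun t : G → G → A => weightedNorm l a t := by
  simp only [weightedNorm_eq]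
  refine (ENNReal.continuous_rpow_const (y := 1 / 2)).comp_lowerSemicontinuous ?_
    fun x y h => ENNReal.rpow_le_rpow h (by norm_num)
  refine lowerSemicontinuous_tsum fun γ => ?_
  have h1 : LowerSemicontinuous fun t : G → G → A => diagSup t γ := by
    refine lowerSemicontinuous_iSup fun x => lowerSemicontinuous_iSup fun y =>
      lowerSemicontinuous_iSup fun _ => Continuous.lowerSemicontinuous ?_
    fun_prop
  have h2 : Continuous fun u : ℝ≥0∞ => (u * weight l a γ) ^ 2 :=
    (ENNReal.continuous_pow 2).comp (ENNReal.continuous_mul_const ENNReal.ofReal_ne_top)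
  refine h2.comp_lowerSemicontinuous h1 fun u v h => ?_
  exact pow_le_pow_left₀ zero_le (mul_le_mul_left h _) 2

/-- The intersection of the weighted spaces is complete: the entries of a Cauchy sequence converge,
and the weighted norms are lower semicontinuous for entrywise convergence. -/
theorem weightedSpaceInf_complete {m : ℝ} (hm0 : 0 ≤ m) (hm : ∑' γ, weight l (-m) γ ≠ ∞)
    (t : ℕ → G → G → A) (ht : ∀ n, t n ∈ weightedSpaceInf A l)
    (hc : ∀ a : ℝ, 0 ≤ a → ∀ ε : ℝ≥0∞, 0 < ε → ∃ N : ℕ, ∀ m ≥ N, ∀ n ≥ N,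
      weightedNorm l a (t m - t n) < ε) :
    ∃ s ∈ weightedSpaceInf A l, ∀ a : ℝ, 0 ≤ a →
      Tendsto (fun n => weightedNorm l a (t n - s)) atTop (𝓝 0) := by
  have h1 : ∀ x y, ∃ b, Tendsto (fun n => t n x y) atTop (𝓝 b) := by
    intro x y
    refine cauchySeq_tendsto_of_complete (EMetric.cauchySeq_iff.2 fun ε hε => ?_)
    obtain ⟨N, hN⟩ := hc 0 le_rfl ε hε
    refine ⟨N, fun m hm n hn => ?_⟩
    rw [edist_eq_enorm_sub]
    exact (enorm_le_weightedNorm le_rfl (t m - t n) x y).trans_lt (hN m hm n hn)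
  choose s hs using h1
  have h2 : ∀ a : ℝ, 0 ≤ a → ∀ ε : ℝ≥0∞, 0 < ε →
      ∃ N : ℕ, ∀ n ≥ N, weightedNorm l a (t n - s) ≤ ε := by
    intro a ha ε hε
    obtain ⟨N, hN⟩ := hc a ha ε hε
    refine ⟨N, fun n hn => ?_⟩
    have h3 : Tendsto (fun m => t n - t m) atTop (𝓝 (t n - s)) := by
      refine tendsto_const_nhds.sub ?_
      rw [tendsto_pi_nhds]
      exact fun x => tendsto_pi_nhds.2 fun y => hs x y
    refine ((lowerSemicontinuous_weightedNorm a).isClosed_preimage ε).mem_of_tendsto h3 ?_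
    filter_upwards [eventually_ge_atTop N] with k hk
    exact (hN n hn k hk).le
  refine ⟨s, (mem_weightedSpaceInf_iff hm0 hm).2 fun a ha => ?_, fun a ha => ?_⟩
  · obtain ⟨N, hN⟩ := h2 (a + m) (by linarith) 1 one_pos
    obtain ⟨C, hC⟩ := exists_oneNorm_le (A := A) hm0 hm
    have h3 : oneNorm l a (t N - s) ≠ ∞ :=
      ne_top_of_le_ne_top (ENNReal.mul_ne_top ENNReal.coe_ne_top
        (ne_top_of_le_ne_top ENNReal.one_ne_top (hN N le_rfl))) (hC a _)
    have h4 := (mem_weightedSpaceInf_iff hm0 hm).1 (ht N) a ha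
    refine ne_top_of_le_ne_top (ENNReal.add_ne_top.2 ⟨h4, h3⟩) (oneNorm_le_add fun x y => ?_)
    have h5 : s x y = t N x y - (t N - s) x y := (sub_sub_cancel _ _).symm
    rw [h5]
    exact enorm_sub_le
  · rw [ENNReal.tendsto_nhds_zero]
    intro ε hε
    obtain ⟨N, hN⟩ := h2 a ha ε hε
    exact eventually_atTop.2 ⟨N, hN⟩

end Norms

/-! ### Families with bounded iterated commutators -/

section Commutators

variable {ι B : Type*} [NormedRing B]

/-- The iterated commutators `[M i, [M i, …, [M i, X i]]]` of length at most `k` are bounded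
uniformly in the index `i`. -/
def BoundedCommutators (M : ι → B) : ℕ → (ι → B) → Prop
  | 0, X => ∃ C : ℝ, ∀ i, ‖X i‖ ≤ C
  | k + 1, X => (∃ C : ℝ, ∀ i, ‖X i‖ ≤ C) ∧ BoundedCommutators M k fun i => M i * X i - X i * M i

namespace BoundedCommutators

variable {M : ι → B} {k : ℕ} {X Y : ι → B}

theorem bounded (h : BoundedCommutators M k X) : ∃ C : ℝ, ∀ i, ‖X i‖ ≤ C := by
  cases k with
  | zero => exact h
  | succ k => exact h.1

theorem of_succ (h : BoundedCommutators M (k + 1) X) : BoundedCommutators M k X := by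
  induction k generalizing X with
  | zero => exact h.1
  | succ k ih => exact ⟨h.1, ih h.2⟩

theorem neg (h : BoundedCommutators M k X) : BoundedCommutators M k fun i => -X i := by
  have h0 : ∃ C : ℝ, ∀ i, ‖-X i‖ ≤ C := by simpa only [norm_neg] using h.bounded
  induction k generalizing X with
  | zero => exact h0
  | succ k ih =>
    refine ⟨h0, ?_⟩
    convert ih h.2 (by simpa only [norm_neg] using h.2.bounded) using 2 with i
    noncomm_ring

theorem add (hX : BoundedCommutators M k X) (hY : BoundedCommutators M k Y) :
    BoundedCommutators M k fun i => X i + Y i := by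
  have h0 : ∀ {X Y : ι → B}, (∃ C : ℝ, ∀ i, ‖X i‖ ≤ C) → (∃ C : ℝ, ∀ i, ‖Y i‖ ≤ C) →
      ∃ C : ℝ, ∀ i, ‖X i + Y i‖ ≤ C := by
    rintro X Y ⟨C, hC⟩ ⟨D, hD⟩
    exact ⟨C + D, fun i => (norm_add_le _ _).trans (add_le_add (hC i) (hD i))⟩
  induction k generalizing X Y with
  | zero => exact h0 hX hY
  | succ k ih =>
    refine ⟨h0 hX.1 hY.1, ?_⟩
    convert ih hX.2 hY.2 using 2 with i
    noncomm_ring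

theorem mul (hX : BoundedCommutators M k X) (hY : BoundedCommutators M k Y) :
    BoundedCommutators M k fun i => X i * Y i := by
  have h0 : ∀ {X Y : ι → B}, (∃ C : ℝ, ∀ i, ‖X i‖ ≤ C) → (∃ C : ℝ, ∀ i, ‖Y i‖ ≤ C) →
      ∃ C : ℝ, ∀ i, ‖X i * Y i‖ ≤ C := by
    rintro X Y ⟨C, hC⟩ ⟨D, hD⟩
    exact ⟨C * D, fun i => (norm_mul_le _ _).trans (mul_le_mul (hC i) (hD i) (norm_nonneg _)
      ((norm_nonneg _).trans (hC i)))⟩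
  induction k generalizing X Y with
  | zero => exact h0 hX hY
  | succ k ih =>
    refine ⟨h0 hX.1 hY.1, ?_⟩
    convert (ih hX.2 hY.of_succ).add (ih hX.of_succ hY.2) using 2 with i
    noncomm_ring

/-- Bounded iterated commutators pass to a bounded family of inverses, since
`[M, X⁻¹] = -X⁻¹ [M, X] X⁻¹`. -/
theorem inverse (hX : BoundedCommutators M k X) (hY : ∃ C : ℝ, ∀ i, ‖Y i‖ ≤ C)
    (h1 : ∀ i, X i * Y i = 1) (h2 : ∀ i, Y i * X i = 1) : BoundedCommutators M k Y := by
  induction k with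
  | zero => exact hY
  | succ k ih =>
    refine ⟨hY, ?_⟩
    have h3 := ih hX.of_succ
    convert ((h3.mul hX.2).mul h3).neg using 2 with i
    calc M i * Y i - Y i * M i
        = (Y i * X i) * (M i * Y i) - Y i * M i * (X i * Y i) := by
          rw [h1, h2, one_mul, mul_one]
      _ = _ := by noncomm_ring

theorem iterate (h : BoundedCommutators M k X) :
    ∃ C : ℝ, ∀ i, ‖(fun Z => M i * Z - Z * M i)^[k] (X i)‖ ≤ C := by
  induction k generalizing X with
  | zero => exact h
  | succ k ih =>
    simp only [Function.iterate_succ_apply]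
    exact ih h.2

theorem of_iterate
    (h : ∀ j ≤ k, ∃ C : ℝ, ∀ i, ‖(fun Z => M i * Z - Z * M i)^[j] (X i)‖ ≤ C) :
    BoundedCommutators M k X := by
  induction k generalizing X with
  | zero => exact h 0 le_rfl
  | succ k ih =>
    refine ⟨h 0 (Nat.zero_le _), ih fun j hj => ?_⟩
    simpa only [Function.iterate_succ_apply] using h (j + 1) (Nat.succ_le_succ hj)

end BoundedCommutators

end Commutators

/-! ### Commutators with multiplication operators -/

section Multiplication

variable {G A : Type*} [CStarAlgebra A]

theorem norm_algebraMap_le {c C : ℝ} (h : |c| ≤ C) : ‖algebraMap ℂ A (c : ℂ)‖ ≤ C := by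
  rw [Algebra.algebraMap_eq_smul_one, norm_smul, Complex.norm_real, Real.norm_eq_abs]
  exact (mul_le_of_le_one_right (abs_nonneg _) norm_one_le_one).trans h

variable (A) in
/-- Multiplication by a bounded real function on `ℓ²(G, A)`. -/
noncomputable def mulOp (f : G → ℝ) (C : ℝ) (hf : ∀ x, |f x| ≤ C) : L2 G A →L[ℂ] L2 G A :=
  diagOp (fun x => algebraMap ℂ A (f x : ℂ)) C (fun x => norm_algebraMap_le (hf x)) (Equiv.refl G)

theorem mulOp_apply {f : G → ℝ} {C : ℝ} (hf : ∀ x, |f x| ≤ C) (ξ : L2 G A) (x : G) :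
    mulOp A f C hf ξ x = (f x : ℂ) • ξ x := by
  rw [Algebra.smul_def]
  rfl

theorem Represents.commutator {T : L2 G A →L[ℂ] L2 G A} {t : G → G → A} (hT : Represents T t)
    {f : G → ℝ} {C : ℝ} (hf : ∀ x, |f x| ≤ C) :
    Represents (mulOp A f C hf * T - T * mulOp A f C hf)
      fun x y => ((f x - f y : ℝ) : ℂ) • t x y := by
  intro ξ x
  have h1 := ((hT ξ x).const_smul (f x : ℂ)).sub (hT (mulOp A f C hf ξ) x)
  rw [← mulOp_apply hf] at h1
  have h2 : (fun y => ((f x - f y : ℝ) : ℂ) • t x y * ξ y) =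
      fun y => (f x : ℂ) • (t x y * ξ y) - t x y * mulOp A f C hf ξ y := by
    funext y
    rw [mulOp_apply, Complex.ofReal_sub, sub_smul, sub_mul, smul_mul_assoc, smul_mul_assoc,
      mul_smul_comm]
  rw [← h2] at h1
  exact h1

theorem Represents.iterate_commutator {T : L2 G A →L[ℂ] L2 G A} {t : G → G → A}
    (hT : Represents T t) {f : G → ℝ} {C : ℝ} (hf : ∀ x, |f x| ≤ C) (k : ℕ) :
    Represents ((fun Z => mulOp A f C hf * Z - Z * mulOp A f C hf)^[k] T)
      fun x y => (((f x - f y) ^ k : ℝ) : ℂ) • t x y := by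
  induction k with
  | zero => simpa using hT
  | succ k ih =>
    rw [Function.iterate_succ_apply']
    convert ih.commutator hf using 3 with x y
    rw [smul_smul, ← Complex.ofReal_mul, pow_succ']

end Multiplication

/-! ### Decay of the inverse -/

section Inverse

variable {G A : Type*} [Group G] [CStarAlgebra A]

/-- A bounded function on `G` that is Lipschitz with constant `1` for the metric `d`. -/
structure BddLipschitz (l : ProperLength G) where
  /-- the function -/
  toFun : G → ℝ
  /-- a bound for its absolute values -/
  bound : ℝ
  abs_le : ∀ x, |toFun x| ≤ bound
  abs_sub_le : ∀ x y, |toFun x - toFun y| ≤ l.dist x y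

theorem ProperLength.dist_nonneg (l : ProperLength G) (x y : G) : 0 ≤ l.dist x y := l.nonneg _

theorem ProperLength.dist_triangle (l : ProperLength G) (x y z : G) :
    l.dist x z ≤ l.dist x y + l.dist y z := by
  have h := l.mul_le' (z⁻¹ * y) (y⁻¹ * x)
  rw [show z⁻¹ * y * (y⁻¹ * x) = z⁻¹ * x by group] at h
  simp only [ProperLength.dist]
  linarith

theorem ProperLength.dist_comm (l : ProperLength G) (x y : G) : l.dist x y = l.dist y x := by
  rw [ProperLength.dist, ← l.inv', mul_inv_rev, inv_inv, ProperLength.dist]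

theorem ProperLength.dist_self (l : ProperLength G) (x : G) : l.dist x x = 0 := by
  rw [ProperLength.dist, inv_mul_cancel, (l.eq_zero_iff' 1).2 rfl]

/-- The distance to the point `z`, truncated at height `N`. -/
noncomputable def truncDist (l : ProperLength G) (z : G) (N : ℝ) (hN : 0 ≤ N) :
    BddLipschitz l where
  toFun x := min (l.dist x z) N
  bound := N
  abs_le x := by
    rw [abs_of_nonneg (le_min (l.dist_nonneg _ _) hN)]
    exact min_le_right _ _
  abs_sub_le x y := by
    refine (abs_min_sub_min_le_max _ _ _ _).trans ?_
    rw [sub_self, abs_zero, max_eq_left (abs_nonneg _), abs_sub_le_iff]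
    have h1 := l.dist_triangle x y z
    have h2 := l.dist_triangle y x z
    rw [l.dist_comm y x] at h2
    constructor <;> linarith

/-- The iterated commutators of an operator in the weighted class with multiplication by bounded
`1`-Lipschitz functions are bounded uniformly in the function: the matrix of the commutator of
order `k` is dominated by `d(x, y)^k ‖t(x, y)‖`. -/
theorem Represents.boundedCommutators {l : ProperLength G} {T : L2 G A →L[ℂ] L2 G A} {t : G → G → A}
    (hT : Represents T t) (ht : ∀ a : ℝ, 0 ≤ a → oneNorm l a t ≠ ∞) (k : ℕ) :
    BoundedCommutators (fun f : BddLipschitz l => mulOp A f.toFun f.bound f.abs_le) k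
      fun _ => T := by
  refine BoundedCommutators.of_iterate fun j _ => ⟨(oneNorm l j t).toReal, fun f => ?_⟩
  have h1 := (hT.iterate_commutator f.abs_le j).enorm_le_tsum_diagSup l
  rw [← toReal_enorm]
  refine ENNReal.toReal_mono (ht j (Nat.cast_nonneg j))
    (h1.trans (ENNReal.tsum_le_tsum fun γ => diagSup_le ?_))
  rintro x y rfl
  rw [enorm_smul, mul_comm]
  refine mul_le_mul' (enorm_le_diagSup t x y) ?_
  rw [weight_natCast, ← ofReal_norm, Complex.norm_real, Real.norm_eq_abs, abs_pow]
  refine ENNReal.ofReal_le_ofReal (pow_le_pow_left₀ (abs_nonneg _) ?_ j)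
  have h2 := f.abs_sub_le x y
  rw [ProperLength.dist] at h2
  linarith

/-- The matrix of the inverse of an operator in the weighted class decays rapidly. The entry at
`(x, z)` of the iterated commutator of the inverse with the truncated distance to `z` is
`d(x, z)^k` times the entry of the inverse, and the commutator is bounded uniformly in `z`. -/
theorem Represents.inverse_decay {l : ProperLength G} {S T : L2 G A →L[ℂ] L2 G A}
    {s t : G → G → A}
    (hT : Represents T t) (ht : ∀ a : ℝ, 0 ≤ a → oneNorm l a t ≠ ∞) (hS : Represents S s)
    (h1 : T * S = 1) (h2 : S * T = 1) (k : ℕ) :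
    ∃ C : ℝ, ∀ x y, ‖s x y‖ * l.dist x y ^ k ≤ C := by
  obtain ⟨C, hC⟩ := ((hT.boundedCommutators ht k).inverse (Y := fun _ => S) ⟨‖S‖, fun _ => le_rfl⟩
    (fun _ => h1) (fun _ => h2)).iterate
  refine ⟨C, fun x z => ?_⟩
  have h3 : 0 ≤ l.dist x z := l.dist_nonneg x z
  -- Truncating at height `d(x, z)` keeps the value of the distance at `x`.
  let f := truncDist l z (l.dist x z) h3
  have h4 : f.toFun x - f.toFun z = l.dist x z := by
    change min (l.dist x z) (l.dist x z) - min (l.dist z z) (l.dist x z) = _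
    rw [l.dist_self, min_self, min_eq_left h3, sub_zero]
  have h5 := ((hS.iterate_commutator f.abs_le k).norm_matrix_le x z).trans (hC f)
  rw [h4, norm_smul, Complex.norm_real, Real.norm_of_nonneg (pow_nonneg h3 k), mul_comm] at h5
  exact h5

end Inverse

/-! ### The algebra of operators with rapidly decaying matrices -/

section Algebra

variable {G A : Type*} [Group G] [CStarAlgebra A] {l : ProperLength G} {m : ℝ}

/-- The operators with a matrix of finite propagation lie in the weighted class. -/
theorem exists_mem_weightedSpaceInf_of_mem_preRoe (hm0 : 0 ≤ m)
    (hm : ∑' γ, weight l (-m) γ ≠ ∞) {T : L2 G A →L[ℂ] L2 G A} (hT : T ∈ preRoe A l) :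
    ∃ t ∈ weightedSpaceInf A l, Represents T t := by
  obtain ⟨t, ⟨R, hR⟩, ht⟩ := hT
  refine ⟨t, (mem_weightedSpaceInf_iff hm0 hm).2 fun a _ =>
    oneNorm_ne_top_of_decay hm (fun k => ⟨‖T‖ * max R 0 ^ k, fun x y => ?_⟩) a, ht⟩
  by_cases h : R < l.dist x y
  · rw [hR x y h, norm_zero, zero_mul]
    positivity
  · exact mul_le_mul (ht.norm_matrix_le x y)
      (pow_le_pow_left₀ (l.dist_nonneg x y) (le_max_of_le_left (not_lt.1 h)) k)
      (pow_nonneg (l.dist_nonneg x y) k) (norm_nonneg _)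

variable (A) in
/-- The operators in the Roe algebra whose matrix lies in all weighted spaces, as a subalgebra.
The exponent `m` only witnesses that the group has polynomial growth. -/
def weightedAlgebra (hm0 : 0 ≤ m) (hm : ∑' γ, weight l (-m) γ ≠ ∞) :
    Subalgebra ℂ (roeAlgebra A l) where
  carrier := {T | ∃ t ∈ weightedSpaceInf A l, Represents (T : L2 G A →L[ℂ] L2 G A) t}
  mul_mem' := by
    rintro S T ⟨s, hs, hS⟩ ⟨t, ht, hT⟩
    refine ⟨_, (mem_weightedSpaceInf_iff hm0 hm).2 fun a ha => ?_, hS.mul hT⟩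
    exact ne_top_of_le_ne_top
      (ENNReal.mul_ne_top ((mem_weightedSpaceInf_iff hm0 hm).1 hs a ha)
        ((mem_weightedSpaceInf_iff hm0 hm).1 ht a ha))
      (oneNorm_mul_le ha (hS.hasSum_mul hT (hS.mul hT)))
  add_mem' := by
    rintro S T ⟨s, hs, hS⟩ ⟨t, ht, hT⟩
    refine ⟨s + t, (mem_weightedSpaceInf_iff hm0 hm).2 fun a ha => ?_, hS.add hT⟩
    exact ne_top_of_le_ne_top
      (ENNReal.add_ne_top.2 ⟨(mem_weightedSpaceInf_iff hm0 hm).1 hs a ha,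
        (mem_weightedSpaceInf_iff hm0 hm).1 ht a ha⟩)
      (oneNorm_le_add fun x y => enorm_add_le _ _)
  algebraMap_mem' c := exists_mem_weightedSpaceInf_of_mem_preRoe hm0 hm
    ((preRoe A l).algebraMap_mem c)

theorem mem_weightedAlgebra_iff (hm0 : 0 ≤ m) (hm : ∑' γ, weight l (-m) γ ≠ ∞)
    {T : roeAlgebra A l} : T ∈ weightedAlgebra A hm0 hm ↔
      ∃ t ∈ weightedSpaceInf A l, Represents (T : L2 G A →L[ℂ] L2 G A) t := Iff.rfl

theorem dense_weightedAlgebra (hm0 : 0 ≤ m) (hm : ∑' γ, weight l (-m) γ ≠ ∞) :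
    Dense (weightedAlgebra A hm0 hm : Set (roeAlgebra A l)) := by
  rw [Metric.dense_iff]
  intro T ε hε
  have hT : (T : L2 G A →L[ℂ] L2 G A) ∈ closure (preRoe A l : Set (L2 G A →L[ℂ] L2 G A)) := by
    rw [← Subalgebra.topologicalClosure_coe]
    exact T.2
  obtain ⟨S, hS, hST⟩ := Metric.mem_closure_iff.1 hT ε hε
  refine ⟨⟨S, (preRoe A l).le_topologicalClosure hS⟩, ?_,
    exists_mem_weightedSpaceInf_of_mem_preRoe hm0 hm hS⟩
  rw [Metric.mem_ball, dist_comm]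
  exact hST

theorem weightedAlgebra_inverse_closed (hm0 : 0 ≤ m) (hm : ∑' γ, weight l (-m) γ ≠ ∞)
    {T S : roeAlgebra A l} (hT : T ∈ weightedAlgebra A hm0 hm) (h1 : T * S = 1) (h2 : S * T = 1) :
    S ∈ weightedAlgebra A hm0 hm := by
  obtain ⟨t, ht, hTt⟩ := hT
  have h1' : (T : L2 G A →L[ℂ] L2 G A) * (S : L2 G A →L[ℂ] L2 G A) = 1 :=
    congrArg Subtype.val h1
  have h2' : (S : L2 G A →L[ℂ] L2 G A) * (T : L2 G A →L[ℂ] L2 G A) = 1 :=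
    congrArg Subtype.val h2
  have hS := hTt.of_mul_eq_one h1' h2'
  exact ⟨_, (mem_weightedSpaceInf_iff hm0 hm).2 fun a _ => oneNorm_ne_top_of_decay hm
    (hTt.inverse_decay ((mem_weightedSpaceInf_iff hm0 hm).1 ht) hS h1' h2') a, hS⟩

end Algebra

end RoeCoeff

/-- An inverse-closed subalgebra is spectrally invariant. -/
theorem Subalgebra.spectrum_eq_of_inverse_closed {R B : Type*} [CommRing R] [Ring B] [Algebra R B]
    (W : Subalgebra R B) (h : ∀ T ∈ W, ∀ S : B, T * S = 1 → S * T = 1 → S ∈ W) (T : W) :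
    spectrum R T = spectrum R (T : B) := by
  ext c
  rw [spectrum.mem_iff, spectrum.mem_iff, not_iff_not]
  constructor
  · exact fun hu => hu.map W.val
  · rintro ⟨u, hu⟩
    have h1 : (u : B) ∈ W := by
      rw [hu]
      exact W.sub_mem (W.algebraMap_mem c) T.2
    have h2 : (↑u⁻¹ : B) ∈ W := h _ h1 _ u.mul_inv u.inv_mul
    exact ⟨⟨⟨u, h1⟩, ⟨_, h2⟩, Subtype.ext u.mul_inv, Subtype.ext u.inv_mul⟩, Subtype.ext hu⟩

theorem mainTheorem1 {G A : Type*} [Group G] [Countable G] [CStarAlgebra A]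
    (l : RoeCoeff.ProperLength G) (a₀ : ℝ) (ha₀ : 0 < a₀)
    (hG : RoeCoeff.HasGrowth l (RoeCoeff.polyWeight a₀)) :
    -- every matrix in `W_a^∞` gives an operator in the Roe algebra
    (∀ t ∈ RoeCoeff.weightedSpaceInf A l,
      ∃! T : RoeCoeff.roeAlgebra A l, RoeCoeff.Represents (T : _ →L[ℂ] _) t) ∧
    -- these operators form a (unital) subalgebra `W`
    ∃ W : Subalgebra ℂ (RoeCoeff.roeAlgebra A l),
      (∀ T : RoeCoeff.roeAlgebra A l,
        T ∈ W ↔ ∃ t ∈ RoeCoeff.weightedSpaceInf A l, RoeCoeff.Represents (T : _ →L[ℂ] _) t) ∧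
      -- `W` is dense
      Dense (W : Set (RoeCoeff.roeAlgebra A l)) ∧
      -- `W` is inverse-closed, hence spectrally invariant
      (∀ T ∈ W, ∀ S : RoeCoeff.roeAlgebra A l, T * S = 1 → S * T = 1 → S ∈ W) ∧
      (∀ T : W, spectrum ℂ T = spectrum ℂ (T : RoeCoeff.roeAlgebra A l)) ∧
      -- multiplication is jointly continuous for the family of weighted norms
      (∀ a : ℝ, 0 ≤ a → ∃ b : ℝ, 0 ≤ b ∧ ∃ C : ℝ≥0, ∀ S ∈ W, ∀ T ∈ W, ∀ s t r : G → G → A,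
        RoeCoeff.Represents (S : _ →L[ℂ] _) s → RoeCoeff.Represents (T : _ →L[ℂ] _) t →
        RoeCoeff.Represents ((S * T : RoeCoeff.roeAlgebra A l) : _ →L[ℂ] _) r →
        RoeCoeff.weightedNorm l a r ≤
          C * RoeCoeff.weightedNorm l b s * RoeCoeff.weightedNorm l b t) ∧
      -- the inclusion of `W` into the Roe algebra is continuous
      (∃ b : ℝ, 0 ≤ b ∧ ∃ C : ℝ≥0, ∀ T ∈ W, ∀ t : G → G → A,
        RoeCoeff.Represents (T : _ →L[ℂ] _) t → ‖T‖ₑ ≤ C * RoeCoeff.weightedNorm l b t) ∧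
      -- `W_a^∞` is complete for the family of weighted norms
      (∀ t : ℕ → G → G → A, (∀ n, t n ∈ RoeCoeff.weightedSpaceInf A l) →
        (∀ a : ℝ, 0 ≤ a → ∀ ε : ℝ≥0∞, 0 < ε → ∃ N : ℕ, ∀ m ≥ N, ∀ n ≥ N,
          RoeCoeff.weightedNorm l a (t m - t n) < ε) →
        ∃ s ∈ RoeCoeff.weightedSpaceInf A l, ∀ a : ℝ, 0 ≤ a →
          Tendsto (fun n => RoeCoeff.weightedNorm l a (t n - s)) atTop (𝓝 0)) := by
  obtain ⟨m, hm0, hm⟩ := hG.exists_tsum_weight_ne_top ha₀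
  have hmem : ∀ {t : G → G → A}, t ∈ RoeCoeff.weightedSpaceInf A l ↔
      ∀ a : ℝ, 0 ≤ a → RoeCoeff.oneNorm l a t ≠ ∞ := RoeCoeff.mem_weightedSpaceInf_iff hm0 hm
  obtain ⟨C, hC⟩ := RoeCoeff.exists_oneNorm_le (A := A) hm0 hm
  refine ⟨fun t ht => ?_, RoeCoeff.weightedAlgebra A hm0 hm,
    fun T => RoeCoeff.mem_weightedAlgebra_iff hm0 hm, RoeCoeff.dense_weightedAlgebra hm0 hm,
    fun T hT S h1 h2 => RoeCoeff.weightedAlgebra_inverse_closed hm0 hm hT h1 h2,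
    Subalgebra.spectrum_eq_of_inverse_closed _ fun T hT S h1 h2 =>
      RoeCoeff.weightedAlgebra_inverse_closed hm0 hm hT h1 h2,
    fun a ha => ⟨a + m, by linarith, C * C, fun S _ T _ s t r hS hT hr => ?_⟩,
    ⟨m, hm0, C, fun T _ t hT => ?_⟩, RoeCoeff.weightedSpaceInf_complete hm0 hm⟩
  · have h := hmem.1 ht 0 le_rfl
    rw [RoeCoeff.oneNorm_zero] at h
    obtain ⟨T, hT, hTt, -⟩ := RoeCoeff.exists_represents_of_tsum_diagSup l h
    exact ⟨⟨T, hT⟩, hTt, fun S hS => Subtype.ext (hS.operator_unique hTt)⟩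
  · calc RoeCoeff.weightedNorm l a r
        ≤ RoeCoeff.oneNorm l a r := RoeCoeff.weightedNorm_le_oneNorm l a r
      _ ≤ RoeCoeff.oneNorm l a s * RoeCoeff.oneNorm l a t :=
        RoeCoeff.oneNorm_mul_le ha (hS.hasSum_mul hT hr)
      _ ≤ (C * RoeCoeff.weightedNorm l (a + m) s) * (C * RoeCoeff.weightedNorm l (a + m) t) :=
        mul_le_mul' (hC a s) (hC a t)
      _ = _ := by
        rw [ENNReal.coe_mul]
        ring
  · have h := hC 0 t
    rw [zero_add, RoeCoeff.oneNorm_zero] at h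
    exact (hT.enorm_le_tsum_diagSup l).trans h
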